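/- For a family $\mathcal B$ of sets and an infinite cardinal $\kappa$, say that $\mathcal B$ is $\kappa^{op}$-like if every $U\in\mathcal B$ is contained in fewer than $\kappa$ members of $\mathcal B$. The Noetherian type $\mathrm{Nt}(X)$ of a topological space $X$ is the least infinite cardinal $\kappa$ such that $X$ has a $\kappa^{op}$-like base. Let $\delta\mathrm{Nt}(X)=\sup\{\mathrm{Nt}(D): D \text{ a dense subspace of } X\}$, and let $w(X)$ be the weight of $X$, i.e. the maximum of $\aleph_0$ and the least cardinality of a base of $X$. (a) Let $X$ be a regular space such that every base of $X$ contains an $\mathrm{Nt}(X)^{op}$-like base of $X$. Then $\mathrm{Nt}(D)\le \mathrm{Nt}(X)$ for every dense subspace $D\subseteq X$. (b) Let $X$ be a compact Hausdorff space whose weight $w(X)$ is a regular cardinal, and suppose that at least one of the following conditions holds: (1) $X$ is homogeneous, i.e. for all $x,y\in X$ some homeomorphism of $X$ onto itself maps $x$ to $y$; (2) $X$ is hereditarily normal, i.e. every subspace of $X$ is normal; (3) the Stone–Čech compactification $\beta\omega$ of the discrete space $\omega$ does not embed in $X$; (4) $|X|<2^{w(X)}$. Then $\delta\mathrm{Nt}(X)=\mathrm{Nt}(X)$.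 -/

import Mathlib

open Cardinal TopologicalSpace

universe u

noncomputable section

/-- A preordered set `P` is `κ`-op-like if every element of `P` has fewer than `κ` elements of `P`
above it. -/
def OpLike (κ : Cardinal.{u}) (P : Type u) [Preorder P] : Prop :=
  ∀ p : P, #{x : P // p ≤ x} < κ

/-- The op-character of `P`: the least infinite cardinal `κ` for which `P` is `κ`-op-like. -/
def opCharacter (P : Type u) [Preorder P] : Cardinal.{u} :=
  sInf {κ : Cardinal.{u} | ℵ₀ ≤ κ ∧ OpLike κ P}

/-- The Noetherian type of a space `X`: the least op-character of a base of `X`. A family of sets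
is ordered by inclusion, so that the elements above a member `U` of the base are the members of
the base that contain `U`. -/
def noetherianType (X : Type u) [TopologicalSpace X] : Cardinal.{u} :=
  sInf {κ : Cardinal.{u} | ∃ B : Set (Set X), IsTopologicalBasis B ∧ κ = opCharacter B}

/-- The supremum of the Noetherian types of the dense subspaces of `X`. -/
def denseNoetherianType (X : Type u) [TopologicalSpace X] : Cardinal.{u} :=
  ⨆ D : {D : Set X // Dense D}, noetherianType (D : Set X)

/-- The weight of `X`: the least cardinality of a base, with the usual convention that cardinal
functions take infinite values only (so a finite space has weight `ℵ₀`). -/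
def weight (X : Type u) [TopologicalSpace X] : Cardinal.{u} :=
  max ℵ₀ (sInf {κ : Cardinal.{u} | ∃ B : Set (Set X), IsTopologicalBasis B ∧ κ = #B})

/-- Every base of `X` contains a `κ`-op-like base of `X`. -/
def EveryBaseContainsOpLikeBase (κ : Cardinal.{u}) (X : Type u) [TopologicalSpace X] : Prop :=
  ∀ B : Set (Set X), IsTopologicalBasis B →
    ∃ U : Set (Set X), U ⊆ B ∧ IsTopologicalBasis U ∧ OpLike κ U

/-- A space is homogeneous if its autohomeomorphisms act transitively on its points. -/
def HomogeneousSpace (X : Type u) [TopologicalSpace X] : Prop :=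
  ∀ x y : X, ∃ h : X ≃ₜ X, h x = y

/-- A space is hereditarily normal if all its subspaces are normal. -/
def HereditarilyNormal (X : Type u) [TopologicalSpace X] : Prop :=
  ∀ S : Set X, NormalSpace S

/-- The Stone–Čech compactification of the discrete space of natural numbers embeds in `X`. -/
def EmbedsBetaOmega (X : Type u) [TopologicalSpace X] : Prop :=
  ∃ f : StoneCech ℕ → X, Topology.IsEmbedding f

end

/-! ### Injective regressive ordinal rankings. -/

section Cardinals

/-! In (a), the given base may be taken to consist of regular open sets. Inclusion between such sets
is decided by their traces on a dense subspace, so the traces form a base there that is equally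
op-like.

For (b), compactness suffices: if a compact Hausdorff space has a `μ`-op-like base `B`, every base
`C` contains one (`everyBaseContainsOpLikeBase_of_opLike`), and (a) applies. Pairs `U`, `V` of `B`
with `closure U ⊆ V` are the stages of a recursion. By Miščenko's lemma few pairs contain points of
small order in `B`, so stages can be numbered injectively by ordinals `e P` below the order of every
point of `U`. Each stage covers `closure U` by members of `C` inside `V`, adding only finitely many
sets `A`, each tagged by some `W ∈ B` with `A ⊆ W`. A tag is reused only if it is a subsingleton or
has more than `(e P).card` supersets in `B`. Hence the chosen sets above a given one come from fewer
than `μ` stages. -/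

theorem mk_le_card_of_injOn {Q : Type u} {S : Set Q} {g : Q → Ordinal.{u}} {o : Ordinal.{u}}
    (hg : Set.InjOn g S) (ho : ∀ P ∈ S, g P < o) : #S ≤ o.card := by
  have h := lift_mk_le_lift_mk_of_injective
    (f := fun P : S => (⟨g P, ho P P.2⟩ : Set.Iio o)) (fun P P' h => by
      have := hg P.2 P'.2 (congrArg Subtype.val h)
      exact Subtype.ext this)
  rw [mk_Iio_ordinal, Cardinal.lift_lift] at h
  exact Cardinal.lift_le.{u + 1, u}.1 h

theorem mk_le_max_card_of_injOn {Q : Type u} {S : Set Q} {g : Q → Ordinal.{u}} {o : Ordinal.{u}}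
    (hg : Set.InjOn g S) (ho : ∀ P ∈ S, g P ≤ o) : #S ≤ max ℵ₀ o.card := by
  refine (mk_le_card_of_injOn hg (o := o + 1) fun P hP => Order.lt_add_one_iff.2 (ho P hP)).trans ?_
  rw [Ordinal.card_add, Ordinal.card_one]
  exact add_le_of_le (le_max_left _ _) (le_max_right _ _)
    (one_le_aleph0.trans (le_max_left _ _))

theorem exists_injOn_lt_ord {Q : Type u} {S : Set Q} {θ : Cardinal.{u}} (h : #S ≤ θ) :
    ∃ g : Q → Ordinal.{u}, Set.InjOn g S ∧ ∀ P ∈ S, g P < θ.ord := by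
  classical
  have : #S ≤ #(θ.ord.ToType) := by simpa using h
  obtain ⟨j⟩ := (Cardinal.le_def _ _).1 this
  refine ⟨fun P => if hP : P ∈ S then (Ordinal.ToType.mk.symm (j ⟨P, hP⟩)).1 else 0, ?_, ?_⟩
  · intro P hP P' hP' h
    simp only [hP, hP', dif_pos] at h
    have := j.injective (Ordinal.ToType.mk.symm.injective (Subtype.ext h))
    exact congrArg Subtype.val this
  · intro P hP
    simp only [hP, dif_pos]
    exact (Ordinal.ToType.mk.symm (j ⟨P, hP⟩)).2

variable {Q : Type u} {r : Q → Cardinal.{u}}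

theorem mk_le_of_forall_isRegular
    (hr : ∀ ν : Cardinal.{u}, ℵ₀ < ν → ν.IsRegular → #{P | r P < ν} < ν)
    {θ : Cardinal.{u}} (hθ : ℵ₀ ≤ θ) : #{P | r P ≤ θ} ≤ θ := by
  have := hr (Order.succ θ) (hθ.trans_lt (Order.lt_succ θ)) (isRegular_succ hθ)
  simp only [Order.lt_succ_iff] at this
  exact this

/-- For regular `ν` the values of `r` below `ν` are themselves few; for singular `ν` a short cofinal
family works. -/
theorem exists_small_cover
    (hr : ∀ ν : Cardinal.{u}, ℵ₀ < ν → ν.IsRegular → #{P | r P < ν} < ν)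
    {ν : Cardinal.{u}} (hν : ℵ₀ < ν) :
    ∃ (ι : Type u) (c : ι → Cardinal.{u}), #ι < ν ∧ (∀ i, c i < ν) ∧
      ∀ P, r P < ν → ∃ i, r P ≤ c i := by
  rcases isRegular_or_isSingular hν.le with h | h
  · exact ⟨{P | r P < ν}, fun P => r P.1, hr ν hν h, fun P => P.2, fun P hP => ⟨⟨P, hP⟩, le_rfl⟩⟩
  · obtain ⟨s, hs, hs'⟩ := Order.exists_cof_eq ν.ord.ToType
    refine ⟨s, fun i => (Ordinal.ToType.mk.symm i.1).1.card, ?_, fun i => ?_, fun P hP => ?_⟩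
    · rw [hs', Ordinal.cof_toType]
      exact h.cof_ord_lt
    · exact lt_ord.1 (Ordinal.ToType.mk.symm i.1).2
    · obtain ⟨i, hi, hle⟩ := hs (Ordinal.ToType.mk ⟨(r P).ord, ord_lt_ord.2 hP⟩)
      refine ⟨⟨i, hi⟩, ?_⟩
      have := Ordinal.ToType.mk.symm.monotone hle
      rw [OrderIso.symm_apply_apply] at this
      exact ord_le.1 this

/-- A Fodor-style converse, by induction on `ν`: functions for smaller bounds are glued along a
cover by fewer than `ν` pieces. -/
theorem exists_regressive_small_fibers (h0 : ∀ P, ℵ₀ ≤ r P)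
    (hr : ∀ ν : Cardinal.{u}, ℵ₀ < ν → ν.IsRegular → #{P | r P < ν} < ν) (ν : Cardinal.{u}) :
    ∃ f : Q → Ordinal.{u}, (∀ P, r P ≤ ν → f P < (r P).ord) ∧
      ∀ α : Ordinal.{u}, #{P | r P ≤ ν ∧ f P ≤ α} ≤ max ℵ₀ α.card := by
  classical
  induction ν using WellFoundedLT.induction with
  | ind ν ih =>
  rcases le_or_gt ν ℵ₀ with hν | hν
  · refine ⟨fun _ => 0, fun P _ => lt_ord.2 ?_, fun α => ?_⟩
    · rw [Ordinal.card_zero]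
      exact aleph0_pos.trans_le (h0 P)
    · refine ((mk_le_mk_of_subset fun P hP => ?_).trans
        (mk_le_of_forall_isRegular hr le_rfl)).trans (le_max_left _ _)
      exact hP.1.trans hν
  choose! F hF1 hF2 using ih
  obtain ⟨ι, c, hι, hc, hcov⟩ := exists_small_cover hr hν
  choose i hi using hcov
  obtain ⟨g, hg1, hg2⟩ := exists_injOn_lt_ord (mk_le_of_forall_isRegular hr hν.le)
  set δ : Cardinal.{u} := max ℵ₀ #ι with hδ
  have hδν : δ < ν := max_lt hν hι
  -- Raising values to `δ.ord` makes the pieces contribute only when `δ.ord ≤ α`, and then there are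
  -- at most `α.card` of them.
  refine ⟨fun P => if r P ≤ δ then F δ P else if h : r P < ν then max (F (c (i P h)) P) δ.ord else g P,
    fun P hP => ?_, fun α => ?_⟩
  · dsimp only
    split_ifs with h1 h2
    · exact hF1 δ hδν P h1
    · exact max_lt (hF1 _ (hc _) P (hi P h2)) (ord_lt_ord.2 (not_le.1 h1))
    · have : r P = ν := le_antisymm hP (not_lt.1 h2)
      rw [this]
      exact hg2 P hP
  · set κ := max ℵ₀ α.card with hκ
    have hκ0 : ℵ₀ ≤ κ := le_max_left _ _
    have hsub : {P | r P ≤ ν ∧ (if r P ≤ δ then F δ P else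
        if h : r P < ν then max (F (c (i P h)) P) δ.ord else g P) ≤ α} ⊆
        {P | r P ≤ δ ∧ F δ P ≤ α} ∪
          ((⋃ j ∈ {_j : ι | δ.ord ≤ α}, {P | r P ≤ c j ∧ F (c j) P ≤ α}) ∪
            {P | r P ≤ ν ∧ g P ≤ α}) := by
      rintro P ⟨hP, hle⟩
      split_ifs at hle with h1 h2
      · exact Or.inl ⟨h1, hle⟩
      · refine Or.inr (Or.inl ?_)
        simp only [Set.mem_iUnion]
        exact ⟨i P h2, (le_max_right _ _).trans hle, hi P h2, (le_max_left _ _).trans hle⟩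
      · exact Or.inr (Or.inr ⟨hP, hle⟩)
    refine (mk_le_mk_of_subset hsub).trans ((mk_union_le _ _).trans
      (add_le_of_le hκ0 (hF2 δ hδν α) ((mk_union_le _ _).trans (add_le_of_le hκ0 ?_ ?_))))
    · by_cases hα : δ.ord ≤ α
      · refine (mk_biUnion_le _ _).trans ((mul_le_mul' (b := κ) (d := κ) ?_ ?_).trans
          (mul_eq_self hκ0).le)
        · exact (mk_set_le _).trans ((le_max_right _ _).trans
            ((ord_le.1 hα).trans (le_max_right _ _)))
        · exact ciSup_le' fun j => hF2 _ (hc _) α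
      · simp [hα]
    · exact mk_le_max_card_of_injOn (hg1.mono fun P hP => hP.1) fun P hP => hP.2

theorem exists_injective_regressive (h0 : ∀ P, ℵ₀ ≤ r P)
    (hr : ∀ ν : Cardinal.{u}, ℵ₀ < ν → ν.IsRegular → #{P | r P < ν} < ν) :
    ∃ e : Q → Ordinal.{u}, Function.Injective e ∧ ∀ P, e P < (r P).ord := by
  classical
  obtain ⟨f, hf1, hf2⟩ := exists_regressive_small_fibers h0 hr (⨆ P, r P)
  have hle : ∀ P, r P ≤ ⨆ P, r P := fun P => le_ciSup bddAbove_of_small P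
  obtain ⟨n, hn1, hn2⟩ := exists_injOn_lt_ord (mk_le_of_forall_isRegular hr le_rfl)
  have hfib : ∀ α : Ordinal.{u}, #{P | f P = α} ≤ max ℵ₀ α.card := fun α =>
    by
    refine (mk_le_mk_of_subset fun P hP => ?_).trans (hf2 α)
    exact ⟨hle P, le_of_eq hP⟩
  choose h hh1 hh2 using fun α => exists_injOn_lt_ord (hfib α)
  set K : Ordinal.{u} → Ordinal.{u} := fun α => (max ℵ₀ α.card).ord with hK
  have hKmono : Monotone K := fun α β hαβ =>
    ord_le_ord.2 (max_le_max le_rfl (Ordinal.card_le_card hαβ))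
  have hlt : ∀ P P', f P < f P' → K (f P) * f P + h (f P) P < K (f P') * f P' + h (f P') P' := by
    intro P P' hlt
    calc K (f P) * f P + h (f P) P < K (f P) * f P + K (f P) := by
          gcongr
          exact hh2 _ P rfl
      _ = K (f P) * (f P + 1) := by rw [mul_add_one]
      _ ≤ K (f P') * f P' := mul_le_mul' (hKmono hlt.le) (Order.add_one_le_of_lt hlt)
      _ ≤ _ := le_self_add
  -- Fibers of `f` are spread over disjoint blocks, the one for `α` starting at `K α * α` with
  -- length `K α`. Ranks equal to `ℵ₀` are coded separately below `ω`.
  refine ⟨fun P => if r P ≤ ℵ₀ then n P else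
    (ℵ₀ : Cardinal.{u}).ord + (K (f P) * f P + h (f P) P), ?_, fun P => ?_⟩
  · intro P P' hPP'
    dsimp only at hPP'
    split_ifs at hPP' with h1 h2 h2
    · exact hn1 h1 h2 hPP'
    · exact absurd hPP' ((hn2 P h1).trans_le le_self_add).ne
    · exact absurd hPP' ((hn2 P' h2).trans_le le_self_add).ne'
    · have hPP' := (add_right_inj _).1 hPP'
      rcases lt_trichotomy (f P) (f P') with h3 | h3 | h3
      · exact absurd hPP' (hlt _ _ h3).ne
      · rw [h3] at hPP'
        exact hh1 (f P') h3 rfl ((add_right_inj _).1 hPP')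
      · exact absurd hPP' (hlt _ _ h3).ne'
  · dsimp only
    split_ifs with h1
    · exact (hn2 P h1).trans_le (ord_le_ord.2 (h0 P))
    · have hfr : max ℵ₀ (f P).card < r P := max_lt (not_le.1 h1) (lt_ord.1 (hf1 P (hle P)))
      have hhr := lt_ord.1 ((hh2 (f P) P rfl).trans (ord_lt_ord.2 hfr))
      rw [lt_ord, Ordinal.card_add, Ordinal.card_add, Ordinal.card_mul, card_ord, card_ord]
      have h0' := h0 P
      exact add_lt_of_lt h0' (not_le.1 h1) (add_lt_of_lt h0'
        (mul_lt_of_lt h0' hfr ((le_max_right _ _).trans_lt hfr)) hhr)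

end Cardinals

/-! ### Miščenko's lemma for points of small order. -/

section Order

theorem mk_finset_subset_lt {α : Type u} {S : Set α} {ν : Cardinal.{u}} (hν : ℵ₀ < ν)
    (hS : #S < ν) : #{F : Finset α | (F : Set α) ⊆ S} < ν := by
  classical
  have hsub : {F : Finset α | (F : Set α) ⊆ S} ⊆
      Set.range fun G : Finset S => G.map (Function.Embedding.subtype _) := by
    intro F hF
    refine ⟨F.subtype (· ∈ S), ?_⟩
    dsimp only
    rw [Finset.subtype_map]
    exact Finset.filter_true_of_mem fun x hx => hF hx
  refine ((mk_le_mk_of_subset hsub).trans mk_range_le).trans_lt ?_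
  cases finite_or_infinite S
  · exact (mk_lt_aleph0 (α := Finset S)).trans hν
  · rwa [mk_finset_of_infinite]

/-- A form of Miščenko's lemma: in a compact space, fewer than `ν` members of a base meet the set
of points that lie in fewer than `ν` members. -/
theorem mk_base_meeting_lt {X : Type u} [TopologicalSpace X] [CompactSpace X] [T1Space X]
    {B : Set (Set X)} (hB : IsTopologicalBasis B) {ν : Cardinal.{u}} (hν : ℵ₀ < ν)
    (hreg : ν.IsRegular) :
    #{W | W ∈ B ∧ ∃ p ∈ W, #{W' | W' ∈ B ∧ p ∈ W'} < ν} < ν := by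
  classical
  set T : Set X := {p | #{W' | W' ∈ B ∧ p ∈ W'} < ν} with hT
  let M : Set X → Set (Set X) := fun D => ⋃ d ∈ D, {W | W ∈ B ∧ d ∈ W}
  have hM : ∀ D ⊆ T, #D < ν → #(M D) < ν := fun D hD hDν =>
    (card_biUnion_lt_iff_forall_of_isRegular hreg hDν).2 fun d hd => hD hd
  have hpick : ∀ F : Finset (Set X), ∃ x : Option X, (∀ p ∈ x, p ∈ T ∧ p ∉ ⋃₀ (F : Set (Set X))) ∧
      ((∃ p ∈ T, p ∉ ⋃₀ (F : Set (Set X))) → x.isSome) := by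
    intro F
    by_cases h : ∃ p ∈ T, p ∉ ⋃₀ (F : Set (Set X))
    · obtain ⟨p, hp⟩ := h
      exact ⟨some p, by simpa using hp, fun _ => rfl⟩
    · exact ⟨none, by simp, fun h' => absurd h' h⟩
  choose pick hpick1 hpick2 using hpick
  -- Closing off: each finite subfamily of `M (D n)` that fails to cover `T` gets a witness in `D (n
  -- + 1)`. The aim is that every member of `B` meeting `T` meets the union.
  obtain ⟨D, hD0, hD⟩ : ∃ D : ℕ → Set X, D 0 = ∅ ∧ ∀ n, D (n + 1) =
      {p | ∃ F : Finset (Set X), (F : Set (Set X)) ⊆ M (D n) ∧ p ∈ pick F} :=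
    ⟨fun n => n.rec ∅ fun _ E => {p | ∃ F : Finset (Set X), (F : Set (Set X)) ⊆ M E ∧ p ∈ pick F},
      rfl, fun _ => rfl⟩
  have hDT : ∀ n, D n ⊆ T := by
    intro n
    cases n with
    | zero => rw [hD0]; exact Set.empty_subset _
    | succ n =>
      rw [hD]
      rintro p ⟨F, -, hp⟩
      exact (hpick1 F p hp).1
  have hDν : ∀ n, #(D n) < ν := by
    intro n
    induction n with
    | zero => simpa [hD0] using hreg.pos
    | succ n ih =>
      have hsub : D (n + 1) ⊆
          ⋃ F ∈ {F : Finset (Set X) | (F : Set (Set X)) ⊆ M (D n)}, {p | p ∈ pick F} := by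
        rw [hD]
        rintro p ⟨F, hF, hp⟩
        simp only [Set.mem_iUnion]
        exact ⟨F, hF, hp⟩
      refine (mk_le_mk_of_subset hsub).trans_lt
        ((card_biUnion_lt_iff_forall_of_isRegular hreg
          (mk_finset_subset_lt hν (hM _ (hDT n) ih))).2 fun F _ => ?_)
      refine lt_of_le_of_lt (mk_le_one_iff_set_subsingleton.2 fun p hp q hq => ?_)
        (one_lt_aleph0.trans hν)
      exact Option.mem_unique hp hq
  have hDmono : Monotone D := by
    refine monotone_nat_of_le_succ fun n => ?_
    induction n with
    | zero => rw [hD0]; exact Set.empty_subset _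
    | succ n ih =>
      rw [hD, hD]
      rintro p ⟨F, hF, hp⟩
      exact ⟨F, hF.trans (Set.biUnion_subset_biUnion_left ih), hp⟩
  have hUν : #(⋃ n, D n) < ν := by
    have h1 : (⋃ n, D n) = ⋃ n : ULift.{u} ℕ, D n.down := by
      ext p
      simp
    rw [h1]
    exact (card_iUnion_lt_iff_forall_of_isRegular hreg (by simpa using hν)).2 fun n => hDν _
  refine (mk_le_mk_of_subset ?_).trans_lt (hM (⋃ n, D n) (Set.iUnion_subset hDT) hUν)
  rintro W ⟨hWB, q, hqW, hqT⟩
  by_contra hW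
  have hWD : ∀ d ∈ ⋃ n, D n, d ∉ W := fun d hd hdW => hW (Set.mem_biUnion hd ⟨hWB, hdW⟩)
  have hq : q ∉ closure (⋃ n, D n) := fun hq => by
    obtain ⟨d, hd, hd'⟩ := mem_closure_iff.1 hq W (hB.isOpen hWB) hqW
    exact hWD d hd' hd
  have hex : ∀ p : X, ∃ V ∈ B, p ≠ q → p ∈ V ∧ q ∉ V := by
    intro p
    by_cases hpq : p = q
    -- A dummy value: `q` is outside the closure to be covered.
    · exact ⟨W, hWB, fun h => absurd hpq h⟩
    · obtain ⟨V, hV, hpV, hVs⟩ := hB.exists_subset_of_mem_open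
        (show p ∈ ({q}ᶜ : Set X) from hpq) isOpen_compl_singleton
      exact ⟨V, hV, fun _ => ⟨hpV, fun hqV => hVs hqV rfl⟩⟩
  choose V hVB hV using hex
  have hne : ∀ p ∈ closure (⋃ n, D n), p ≠ q := fun p hp h => hq (h ▸ hp)
  obtain ⟨t, ht, hcov⟩ := isClosed_closure.isCompact.elim_nhds_subcover V
    fun p hp => (hB.isOpen (hVB p)).mem_nhds (hV p (hne p hp)).1
  have hF : ∀ p ∈ t, ∃ n, ∃ d ∈ D n, d ∈ V p := fun p hp => by
    obtain ⟨d, hd, hd'⟩ := mem_closure_iff.1 (ht p hp) (V p) (hB.isOpen (hVB p))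
      (hV p (hne p (ht p hp))).1
    obtain ⟨n, hn⟩ := Set.mem_iUnion.1 hd'
    exact ⟨n, d, hn, hd⟩
  choose! n d hdD hdV using hF
  -- The finite cover avoids `q ∈ T`, so its witness was added to `D`; yet it covers `D`, a
  -- contradiction.
  have hFM : ((t.image V : Finset (Set X)) : Set (Set X)) ⊆ M (D (t.sup n)) := by
    intro A hA
    obtain ⟨p, hp, rfl⟩ := Finset.mem_image.1 (Finset.mem_coe.1 hA)
    exact Set.mem_biUnion (hDmono (Finset.le_sup hp) (hdD p hp)) ⟨hVB p, hdV p hp⟩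
  obtain ⟨x, hx⟩ := Option.isSome_iff_exists.1 (hpick2 (t.image V) ⟨q, hqT, by
    simp only [Finset.coe_image, Set.sUnion_image, Set.mem_iUnion, not_exists]
    exact fun p hp => (hV p (hne p (ht p hp))).2⟩)
  have hxD : x ∈ D (t.sup n + 1) := by
    rw [hD]
    exact ⟨_, hFM, hx⟩
  refine (hpick1 _ x hx).2 ?_
  have := hcov (subset_closure (Set.mem_iUnion.2 ⟨_, hxD⟩))
  simpa using this

end Order

/-! ### Thinning an arbitrary base by recursion. -/

section Construction

theorem mk_biUnion_finset_lt {Q α : Type u} (F : Q → Finset α) {S : Set Q} {μ : Cardinal.{u}}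
    (hμ : ℵ₀ ≤ μ) (hS : #S < μ) : #{x | ∃ P ∈ S, x ∈ F P} < μ := by
  have h : {x | ∃ P ∈ S, x ∈ F P} = ⋃ P ∈ S, (F P : Set α) := by
    ext x
    simp
  rw [h]
  rcases lt_or_ge #S ℵ₀ with hfin | hinf
  · have : S.Finite := lt_aleph0_iff_set_finite.1 hfin
    exact (lt_aleph0_iff_set_finite.2 (this.biUnion fun P _ => (F P).finite_toSet)).trans_le hμ
  · refine ((mk_biUnion_le _ _).trans (mul_le_mul' le_rfl
      (ciSup_le' fun P => (F P).finite_toSet.lt_aleph0.le))).trans_lt ?_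
    exact mul_lt_of_lt hμ hS (hinf.trans_lt hS)

theorem exists_recursive_finset {Q α : Type u} (e : Q → Ordinal.{u})
    (R : Q → Set α → Finset α → Prop)
    (h : ∀ (F : Q → Finset α) (P : Q),
      (∀ P', e P' < e P → R P' {x | ∃ P'' ∈ {P'' | e P'' < e P'}, x ∈ F P''} (F P')) →
      ∃ G, R P {x | ∃ P' ∈ {P' | e P' < e P}, x ∈ F P'} G) :
    ∃ F : Q → Finset α, ∀ P, R P {x | ∃ P' ∈ {P' | e P' < e P}, x ∈ F P'} (F P) := by
  have wf : WellFounded fun P P' : Q => e P < e P' := InvImage.wf e Ordinal.lt_wf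
  let step : ∀ P : Q, (∀ P', e P' < e P → Finset α) → Finset α := fun P IH =>
    Classical.epsilon fun G => R P {x | ∃ P', ∃ h : e P' < e P, x ∈ IH P' h} G
  have hF : ∀ P, wf.fix step P = Classical.epsilon fun G =>
      R P {x | ∃ P' ∈ {P' | e P' < e P}, x ∈ wf.fix step P'} G := by
    intro P
    rw [wf.fix_eq]
    simp only [step, Set.mem_ofPred_eq, exists_prop]
  refine ⟨wf.fix step, fun P => ?_⟩
  induction P using wf.induction with
  | h P ih =>
  have := Classical.epsilon_spec (h (wf.fix step) P ih)
  rw [← hF P] at this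
  exact this

variable {X : Type u} [TopologicalSpace X]

/-- A pair `(A, W)` may be added at a stage of index `κ`, the pairs in `𝒰` having been chosen
before. -/
structure Admissible (B C : Set (Set X)) (κ : Cardinal.{u}) (𝒰 : Set (Set X × Set X))
    (x : Set X × Set X) : Prop where
  nonempty : x.1.Nonempty
  fst_mem : x.1 ∈ C
  snd_mem : x.2 ∈ B
  subset : x.1 ⊆ x.2
  reuse : x.2.Subsingleton ∨ x.2 ∉ Prod.snd '' 𝒰 ∨ (ℵ₀ ≤ κ ∧ κ < #{W | W ∈ B ∧ x.2 ⊆ W})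

/-- If no admissible pair serves `p`, all `W ∈ B` with `p ∈ W ⊆ V` are used tags. For infinite `κ`
each has at most `κ` supersets, so `p` has order at most `κ` and `hsmall` applies; for finite `κ`
there are finitely many such `W`, which isolates `p` and makes a subsingleton tag available. -/
theorem exists_finset_admissible [CompactSpace X] [T2Space X] {B C : Set (Set X)}
    (hB : IsTopologicalBasis B) (hC : IsTopologicalBasis C) {U V : Set X} (hV : IsOpen V)
    (hUV : closure U ⊆ V) {κ : Cardinal.{u}} {𝒰 : Set (Set X × Set X)}
    (h𝒰C : ∀ x ∈ 𝒰, x.1 ∈ C) (h𝒰 : #𝒰 ≤ max ℵ₀ κ) (h𝒰fin : κ < ℵ₀ → 𝒰.Finite)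
    (hsmall : ℵ₀ ≤ κ → ∀ p ∈ closure U, #{W | W ∈ B ∧ p ∈ W} ≤ κ →
      ∃ x ∈ 𝒰, p ∈ x.1 ∧ x.1 ⊆ V) :
    ∃ G : Finset (Set X × Set X), (∀ x ∈ G, Admissible B C κ 𝒰 x) ∧
      ∀ p ∈ closure U, ∃ x, (x ∈ 𝒰 ∨ x ∈ G) ∧ p ∈ x.1 ∧ x.1 ⊆ V := by
  classical
  have key : ∀ p ∈ closure U, ∃ x : Set X × Set X, p ∈ x.1 ∧ x.1 ⊆ V ∧ IsOpen x.1 ∧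
      (x ∈ 𝒰 ∨ Admissible B C κ 𝒰 x) := by
    intro p hp
    by_cases hW : ∃ W ∈ B, p ∈ W ∧ W ⊆ V ∧ (W.Subsingleton ∨ W ∉ Prod.snd '' 𝒰 ∨
        (ℵ₀ ≤ κ ∧ κ < #{W' | W' ∈ B ∧ W ⊆ W'}))
    · obtain ⟨W, hWB, hpW, hWV, hW⟩ := hW
      obtain ⟨A, hA, hpA, hAW⟩ := hC.exists_subset_of_mem_open hpW (hB.isOpen hWB)
      exact ⟨(A, W), hpA, hAW.trans hWV, hC.isOpen hA, Or.inr ⟨⟨p, hpA⟩, hA, hWB, hAW, hW⟩⟩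
    push Not at hW
    set N : Set (Set X) := {W | W ∈ B ∧ p ∈ W ∧ W ⊆ V} with hN
    have hN𝒰 : N ⊆ Prod.snd '' 𝒰 := fun W h => (hW W h.1 h.2.1 h.2.2).2.1
    rcases lt_or_ge κ ℵ₀ with hκ | hκ
    · exfalso
      have hNfin : N.Finite := ((h𝒰fin hκ).image _).subset hN𝒰
      have hO : IsOpen (⋂₀ N) := hNfin.isOpen_sInter fun W h => hB.isOpen h.1
      obtain ⟨W, hWB, hpW, hWO⟩ := hB.exists_subset_of_mem_open
        (show p ∈ ⋂₀ N ∩ V from ⟨fun W h => h.2.1, hUV hp⟩) (hO.inter hV)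
      refine Set.not_subsingleton_iff.2 (hW W hWB hpW (hWO.trans Set.inter_subset_right)).1 ?_
      have hsing : ∀ q ∈ W, q = p := by
        intro q hq
        by_contra hqp
        obtain ⟨W', hW'B, hpW', hW'⟩ := hB.exists_subset_of_mem_open
          (show p ∈ V ∩ {q}ᶜ from ⟨hUV hp, fun h => hqp h.symm⟩)
          (hV.inter isOpen_compl_singleton)
        exact (hW' ((hWO hq).1 W' ⟨hW'B, hpW', hW'.trans Set.inter_subset_left⟩)).2 rfl
      exact fun a ha b hb => (hsing a ha).trans (hsing b hb).symm
    · have hord : #{W | W ∈ B ∧ p ∈ W} ≤ κ := by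
        have hsub : {W | W ∈ B ∧ p ∈ W} ⊆ ⋃ W ∈ N, {W' | W' ∈ B ∧ W ⊆ W'} := by
          rintro W' ⟨hW'B, hpW'⟩
          obtain ⟨W, hWB, hpW, hWs⟩ := hB.exists_subset_of_mem_open
            (show p ∈ W' ∩ V from ⟨hpW', hUV hp⟩) ((hB.isOpen hW'B).inter hV)
          exact Set.mem_biUnion (show W ∈ N from ⟨hWB, hpW, hWs.trans Set.inter_subset_right⟩)
            ⟨hW'B, hWs.trans Set.inter_subset_left⟩
        refine (mk_le_mk_of_subset hsub).trans ((mk_biUnion_le _ _).trans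
          ((mul_le_mul' (b := κ) (d := κ) ?_ ?_).trans (mul_eq_self hκ).le))
        · exact (mk_le_mk_of_subset hN𝒰).trans
            (mk_image_le.trans (h𝒰.trans (max_le hκ le_rfl)))
        · exact ciSup_le' fun W => (hW W W.2.1 W.2.2.1 W.2.2.2).2.2 hκ
      obtain ⟨x, hx, hpx, hxV⟩ := hsmall hκ p hp hord
      exact ⟨x, hpx, hxV, hC.isOpen (h𝒰C x hx), Or.inl hx⟩
  choose! x hpx hxV hxo hx using key
  obtain ⟨t, ht, hcov⟩ := isClosed_closure.isCompact.elim_nhds_subcover (fun p => (x p).1)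
    fun p hp => (hxo p hp).mem_nhds (hpx p hp)
  refine ⟨(t.image x).filter fun y => Admissible B C κ 𝒰 y,
    fun y hy => (Finset.mem_filter.1 hy).2, fun p hp => ?_⟩
  obtain ⟨q, hq, hpq⟩ := Set.mem_iUnion₂.1 (hcov hp)
  refine ⟨x q, ?_, hpq, hxV q (ht q hq)⟩
  exact (hx q (ht q hq)).imp_right fun h =>
    Finset.mem_filter.2 ⟨Finset.mem_image_of_mem x hq, h⟩

/-- The pairs of members of `B` the closure of the first of which is contained in the second. -/
abbrev NestedPair (B : Set (Set X)) : Type u :=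
  {P : Set X × Set X // P.1 ∈ B ∧ P.2 ∈ B ∧ P.1.Nonempty ∧ closure P.1 ⊆ P.2}

theorem exists_injective_regressive_nestedPair [CompactSpace X] [T2Space X] {B : Set (Set X)}
    (hB : IsTopologicalBasis B) :
    ∃ e : NestedPair B → Ordinal.{u}, Function.Injective e ∧
      ∀ P, ∀ p ∈ P.1.1, e P < (max ℵ₀ #{W | W ∈ B ∧ p ∈ W}).ord := by
  let r : NestedPair B → Cardinal.{u} := fun P =>
    max ℵ₀ (⨅ p : P.1.1, #{W | W ∈ B ∧ p.1 ∈ W})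
  have hr : ∀ ν : Cardinal.{u}, ℵ₀ < ν → ν.IsRegular → #{P | r P < ν} < ν := by
    intro ν hν hreg
    set M : Set (Set X) := {W | W ∈ B ∧ ∃ p ∈ W, #{W' | W' ∈ B ∧ p ∈ W'} < ν} with hM
    have hMν : #M < ν := mk_base_meeting_lt hB hν hreg
    have hmem : ∀ P : NestedPair B, r P < ν → P.1.1 ∈ M ∧ P.1.2 ∈ M := by
      intro P hP
      have : Nonempty P.1.1 := P.2.2.2.1.to_subtype
      obtain ⟨p, hp⟩ := exists_lt_of_ciInf_lt ((le_max_right _ _).trans_lt hP)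
      exact ⟨⟨P.2.1, p, p.2, hp⟩, P.2.2.1, p, P.2.2.2.2 (subset_closure p.2), hp⟩
    have hinj : Function.Injective fun P : {P | r P < ν} =>
        ((⟨P.1.1.1, (hmem P.1 P.2).1⟩, ⟨P.1.1.2, (hmem P.1 P.2).2⟩) : M × M) := by
      intro P P' h
      simp only [Prod.mk.injEq, Subtype.mk.injEq] at h
      exact Subtype.ext (Subtype.ext (Prod.ext h.1 h.2))
    refine (mk_le_of_injective hinj).trans_lt ?_
    rw [mk_prod, Cardinal.lift_id]
    exact mul_lt_of_lt hν.le hMν hMν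
  obtain ⟨e, he, her⟩ := exists_injective_regressive (r := r) (fun P => le_max_left _ _) hr
  refine ⟨e, he, fun P p hp => (her P).trans_le (ord_le_ord.2 (max_le_max le_rfl ?_))⟩
  exact ciInf_le' (fun p : P.1.1 => #{W | W ∈ B ∧ p.1 ∈ W}) ⟨p, hp⟩

theorem mk_above_lt_of_opLike {B : Set (Set X)} (hB : IsTopologicalBasis B) {μ : Cardinal.{u}}
    (hop : OpLike μ B) {A : Set X} (hA : IsOpen A) (hne : A.Nonempty) :
    #{W | W ∈ B ∧ A ⊆ W} < μ := by
  obtain ⟨p, hp⟩ := hne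
  obtain ⟨W, hWB, -, hWA⟩ := hB.exists_subset_of_mem_open hp hA
  refine lt_of_le_of_lt ?_ (hop ⟨W, hWB⟩)
  refine mk_le_of_injective
    (f := fun W' => (⟨⟨W'.1, W'.2.1⟩, hWA.trans W'.2.2⟩ : {x : B // ⟨W, hWB⟩ ≤ x})) fun W' W'' h => ?_
  simp only [Subtype.mk.injEq] at h
  exact Subtype.ext h

/-- If a compact Hausdorff space has a `μ`-op-like base, then each of its bases contains one. -/
theorem everyBaseContainsOpLikeBase_of_opLike [CompactSpace X] [T2Space X] {B : Set (Set X)}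
    (hB : IsTopologicalBasis B) {μ : Cardinal.{u}} (hμ : ℵ₀ ≤ μ) (hop : OpLike μ B) :
    EveryBaseContainsOpLikeBase μ X := by
  classical
  intro C hC
  obtain ⟨e, he, hereg⟩ := exists_injective_regressive_nestedPair hB
  obtain ⟨F, hF⟩ := exists_recursive_finset (α := Set X × Set X) e
    (fun P 𝒰 G => (∀ x ∈ G, Admissible B C (e P).card 𝒰 x) ∧
      ∀ p ∈ closure P.1.1, ∃ x, (x ∈ 𝒰 ∨ x ∈ G) ∧ p ∈ x.1 ∧ x.1 ⊆ P.1.2) (by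
    intro F P ih
    have hS : #{P' | e P' < e P} ≤ (e P).card :=
      mk_le_card_of_injOn he.injOn fun P' h => h
    refine exists_finset_admissible hB hC (hB.isOpen P.2.2.1) P.2.2.2.2 ?_ ?_ ?_ ?_
    · rintro x ⟨P', hP', hx⟩
      exact ((ih P' hP').1 x hx).fst_mem
    · refine Order.lt_succ_iff.1 (mk_biUnion_finset_lt F
        ((le_max_left _ _).trans (Order.le_succ _)) (Order.lt_succ_iff.2 ?_))
      exact hS.trans (le_max_right _ _)
    · intro hfin
      exact lt_aleph0_iff_set_finite.1 (mk_biUnion_finset_lt F le_rfl (hS.trans_lt hfin))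
    · intro hinf p hp hord
      obtain ⟨U', hU'B, hpU', hU'⟩ := hB.exists_closure_subset
        ((hB.isOpen P.2.2.1).mem_nhds (P.2.2.2.2 hp))
      -- Since `p` has small order, this pair is an earlier stage and has already covered `p` inside
      -- `V`.
      let P' : NestedPair B := ⟨(U', P.1.2), hU'B, P.2.2.1, ⟨p, hpU'⟩, hU'⟩
      have hP' : e P' < e P := (hereg P' p hpU').trans_le
        ((ord_le_ord.2 (max_le hinf hord)).trans (ord_card_le _))
      obtain ⟨x, hx, hpx, hxV⟩ := (ih P' hP').2 p (subset_closure hpU')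
      refine ⟨x, ?_, hpx, hxV⟩
      rcases hx with ⟨P'', hP'', hx⟩ | hx
      · exact ⟨P'', lt_trans hP'' hP', hx⟩
      · exact ⟨P', hP', hx⟩)
  refine ⟨{A | ∃ P, ∃ x ∈ F P, x.1 = A}, ?_, ?_, ?_⟩
  · rintro A ⟨P, x, hx, rfl⟩
    exact ((hF P).1 x hx).fst_mem
  · refine isTopologicalBasis_of_isOpen_of_nhds ?_ fun p O hpO hO => ?_
    · rintro A ⟨P, x, hx, rfl⟩
      exact hC.isOpen ((hF P).1 x hx).fst_mem
    · obtain ⟨V, hVB, hpV, hVO⟩ := hB.exists_subset_of_mem_open hpO hO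
      obtain ⟨U, hUB, hpU, hUV⟩ := hB.exists_closure_subset ((hB.isOpen hVB).mem_nhds hpV)
      obtain ⟨x, hx, hpx, hxV⟩ :=
        (hF ⟨(U, V), hUB, hVB, ⟨p, hpU⟩, hUV⟩).2 p (subset_closure hpU)
      refine ⟨x.1, ?_, hpx, hxV.trans hVO⟩
      rcases hx with ⟨P, -, hx⟩ | hx
      · exact ⟨P, x, hx, rfl⟩
      · exact ⟨_, x, hx, rfl⟩
  · rintro ⟨A₀, P₀, x₀, hx₀, rfl⟩
    have hadm := (hF P₀).1 x₀ hx₀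
    have hm := mk_above_lt_of_opLike hB hop (hC.isOpen hadm.fst_mem) hadm.nonempty
    set m := #{W | W ∈ B ∧ x₀.1 ⊆ W} with hm_def
    let first : NestedPair B → Set X → Prop := fun P W =>
      (∃ x ∈ F P, x.2 = W) ∧ ∀ P', e P' < e P → ∀ x ∈ F P', x.2 ≠ W
    have hfirst : ∀ P P' W, first P W → first P' W → P = P' := by
      rintro P P' W ⟨⟨x, hx, hxW⟩, h1⟩ ⟨⟨x', hx', hxW'⟩, h2⟩
      rcases lt_trichotomy (e P) (e P') with h | h | h
      · exact absurd hxW (h2 P h x hx)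
      · exact he h
      · exact absurd hxW' (h1 P' h x' hx')
    -- A chosen `A ⊇ x₀.1` other than `x₀.1` has either a fresh tag, charged to the unique first
    -- stage of that tag (`S₁`), or a reused one with at most `m` supersets, which forces `e P <
    -- m.ord` (`S₂`).
    set S₁ : Set (NestedPair B) := {P | ∃ W ∈ {W | W ∈ B ∧ x₀.1 ⊆ W}, first P W} with hS₁
    set S₂ : Set (NestedPair B) := {P | ℵ₀ ≤ m ∧ e P < m.ord} with hS₂
    have hS₁m : #S₁ ≤ m := by
      choose W hW hWf using fun P : S₁ => P.2
      refine mk_le_of_injective (f := fun P => (⟨W P, hW P⟩ : {W | W ∈ B ∧ x₀.1 ⊆ W})) ?_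
      intro P P' h
      have h : W P = W P' := congrArg Subtype.val h
      exact Subtype.ext (hfirst _ _ (W P) (hWf P) (h ▸ hWf P'))
    have hS₂m : #S₂ ≤ m :=
      (mk_le_card_of_injOn he.injOn fun P hP => hP.2).trans (card_ord m).le
    have hS : #(S₁ ∪ S₂ : Set (NestedPair B)) < μ :=
      (mk_union_le _ _).trans_lt (add_lt_of_lt hμ (hS₁m.trans_lt hm) (hS₂m.trans_lt hm))
    have hcount : #({x₀.1} ∪ {A | ∃ P ∈ S₁ ∪ S₂, A ∈ (F P).image Prod.fst} : Set (Set X)) < μ := by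
      refine (mk_union_le _ _).trans_lt (add_lt_of_lt hμ ?_
        (mk_biUnion_finset_lt (fun P => (F P).image Prod.fst) hμ hS))
      rw [mk_singleton]
      exact one_lt_aleph0.trans_le hμ
    refine lt_of_le_of_lt ?_ hcount
    refine mk_le_of_injective (f := fun A => ⟨A.1.1, ?_⟩) fun A A' h => ?_
    · obtain ⟨⟨A, P, x, hx, rfl⟩, hle⟩ := A
      have hle : x₀.1 ⊆ x.1 := hle
      have hx' := (hF P).1 x hx
      rcases hx'.reuse with h | h | ⟨h1, h2⟩
      · left
        obtain ⟨p, hp⟩ := hadm.nonempty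
        refine (Set.Subset.antisymm hle fun q hq => ?_).symm
        rwa [h (hx'.subset hq) (hx'.subset (hle hp))]
      · refine Or.inr ⟨P, Or.inl ⟨x.2, ⟨hx'.snd_mem, hle.trans hx'.subset⟩, ⟨x, hx, rfl⟩, ?_⟩,
          Finset.mem_image_of_mem _ hx⟩
        exact fun P' hP' y hy hyx => h ⟨y, ⟨P', hP', hy⟩, hyx⟩
      · have h3 : #{W | W ∈ B ∧ x.2 ⊆ W} ≤ m := mk_le_mk_of_subset fun W hW =>
          ⟨hW.1, (hle.trans hx'.subset).trans hW.2⟩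
        exact Or.inr ⟨P, Or.inr ⟨h1.trans (h2.le.trans h3), lt_ord.2 (h2.trans_le h3)⟩,
          Finset.mem_image_of_mem _ hx⟩
    · exact Subtype.ext (Subtype.ext (Subtype.mk.inj h))

end Construction

/-! ### Noetherian type and dense subspaces. -/

section NoetherianType

theorem opCharacter_spec (P : Type u) [Preorder P] :
    ℵ₀ ≤ opCharacter P ∧ OpLike (opCharacter P) P := by
  refine csInf_mem (s := {κ : Cardinal.{u} | ℵ₀ ≤ κ ∧ OpLike κ P})
    ⟨Order.succ (max ℵ₀ #P), (le_max_left _ _).trans (Order.le_succ _), fun p => ?_⟩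
  exact Order.lt_succ_iff.2 ((mk_subtype_le _).trans (le_max_right _ _))

theorem noetherianType_spec (X : Type u) [TopologicalSpace X] :
    ℵ₀ ≤ noetherianType X ∧
      ∃ B : Set (Set X), IsTopologicalBasis B ∧ OpLike (noetherianType X) B := by
  obtain ⟨B, hB, h⟩ := csInf_mem
    (s := {κ : Cardinal.{u} | ∃ B : Set (Set X), IsTopologicalBasis B ∧ κ = opCharacter B})
    ⟨_, _, isTopologicalBasis_opens, rfl⟩
  have h : noetherianType X = opCharacter B := h
  rw [h]
  exact ⟨(opCharacter_spec B).1, B, hB, (opCharacter_spec B).2⟩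

theorem noetherianType_le {X : Type u} [TopologicalSpace X] {κ : Cardinal.{u}} (hκ : ℵ₀ ≤ κ)
    {B : Set (Set X)} (hB : IsTopologicalBasis B) (hop : OpLike κ B) : noetherianType X ≤ κ := by
  have h1 : noetherianType X ≤ opCharacter B := csInf_le'
    (show opCharacter B ∈ {κ : Cardinal.{u} | ∃ B : Set (Set X), IsTopologicalBasis B ∧
      κ = opCharacter B} from ⟨B, hB, rfl⟩)
  have h2 : opCharacter B ≤ κ := csInf_le'
    (show κ ∈ {κ : Cardinal.{u} | ℵ₀ ≤ κ ∧ OpLike κ B} from ⟨hκ, hop⟩)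
  exact h1.trans h2

variable {X : Type u} [TopologicalSpace X]

theorem noetherianType_le_of_homeomorph {Y : Type u} [TopologicalSpace Y] (h : X ≃ₜ Y) :
    noetherianType X ≤ noetherianType Y := by
  obtain ⟨hκ, B, hB, hop⟩ := noetherianType_spec Y
  refine noetherianType_le hκ (hB.isInducing h.isInducing) ?_
  rintro ⟨_, U, hU, rfl⟩
  refine lt_of_le_of_lt ?_ (hop ⟨U, hU⟩)
  choose W hWB hW using fun x : {x : (Set.preimage h '' B) // ⟨h ⁻¹' U, U, hU, rfl⟩ ≤ x} => x.1.2
  refine mk_le_of_injective (f := fun x => (⟨⟨W x, hWB x⟩, ?_⟩ : {x : B // ⟨U, hU⟩ ≤ x}))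
    fun x x' hxx' => ?_
  · have hx : h ⁻¹' U ⊆ x.1.1 := x.2
    rw [← hW x, h.surjective.preimage_subset_preimage_iff] at hx
    exact hx
  · have hxx' : W x = W x' := congrArg (fun z => z.1.1) hxx'
    exact Subtype.ext (Subtype.ext (by rw [← hW x, ← hW x', hxx']))

theorem isTopologicalBasis_regularOpen (X : Type u) [TopologicalSpace X] [RegularSpace X] :
    IsTopologicalBasis {U : Set X | interior (closure U) = U} := by
  refine isTopologicalBasis_of_isOpen_of_nhds (fun U hU => ?_) fun p O hpO hO => ?_
  · rw [← show interior (closure U) = U from hU]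
    exact isOpen_interior
  · obtain ⟨U, hU, hpU, hUO⟩ :=
      isTopologicalBasis_opens.exists_closure_subset (hO.mem_nhds hpO)
    have hUo : IsOpen U := hU
    refine ⟨interior (closure U), ?_, hUo.subset_interior_closure hpU,
      interior_subset.trans hUO⟩
    exact interior_closure_idem

theorem subset_of_preimage_subset_of_dense {D : Set X} (hD : Dense D) {U V : Set X}
    (hU : IsOpen U) (hV : interior (closure V) = V)
    (h : ((↑) : D → X) ⁻¹' U ⊆ (↑) ⁻¹' V) : U ⊆ V := by
  rw [← hV]
  refine hU.subset_interior_iff.2 ((hD.open_subset_closure_inter hU).trans (closure_mono ?_))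
  rintro p ⟨hpU, hpD⟩
  exact h (a := ⟨p, hpD⟩) hpU

theorem noetherianType_dense_le [RegularSpace X]
    (h : EveryBaseContainsOpLikeBase (noetherianType X) X) {D : Set X} (hD : Dense D) :
    noetherianType D ≤ noetherianType X := by
  obtain ⟨B, hBr, hB, hop⟩ := h _ (isTopologicalBasis_regularOpen X)
  refine noetherianType_le (noetherianType_spec X).1
    (hB.isInducing (f := ((↑) : D → X)) Topology.IsInducing.subtypeVal) ?_
  rintro ⟨_, U, hU, rfl⟩
  refine lt_of_le_of_lt ?_ (hop ⟨U, hU⟩)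
  choose W hWB hW using fun x : {x : (Set.preimage ((↑) : D → X) '' B) //
    ⟨(↑) ⁻¹' U, U, hU, rfl⟩ ≤ x} => x.1.2
  refine mk_le_of_injective (f := fun x => (⟨⟨W x, hWB x⟩, ?_⟩ : {x : B // ⟨U, hU⟩ ≤ x}))
    fun x x' hxx' => ?_
  · have hx : ((↑) : D → X) ⁻¹' U ⊆ x.1.1 := x.2
    rw [← hW x] at hx
    exact subset_of_preimage_subset_of_dense hD (hB.isOpen hU) (hBr (hWB x)) hx
  · have hxx' : W x = W x' := congrArg (fun z => z.1.1) hxx'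
    exact Subtype.ext (Subtype.ext (by rw [← hW x, ← hW x', hxx']))

theorem denseNoetherianType_eq [CompactSpace X] [T2Space X] :
    denseNoetherianType X = noetherianType X := by
  refine le_antisymm (ciSup_le' fun D => ?_) ?_
  · obtain ⟨hμ, B, hB, hop⟩ := noetherianType_spec X
    exact noetherianType_dense_le (everyBaseContainsOpLikeBase_of_opLike hB hμ hop) D.2
  · exact (noetherianType_le_of_homeomorph (Homeomorph.Set.univ X).symm).trans
      (le_ciSup (f := fun D : {D : Set X // Dense D} => noetherianType (D : Set X))
        bddAbove_of_small ⟨Set.univ, dense_univ⟩)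

end NoetherianType

theorem mainTheorem8 :
    (∀ (X : Type u) [TopologicalSpace X] [RegularSpace X],
      EveryBaseContainsOpLikeBase (noetherianType X) X →
        ∀ D : Set X, Dense D → noetherianType D ≤ noetherianType X) ∧
    (∀ (X : Type u) [TopologicalSpace X] [CompactSpace X] [T2Space X],
      (weight X).IsRegular →
      (HomogeneousSpace X ∨ HereditarilyNormal X ∨ ¬ EmbedsBetaOmega X ∨
        #X < (2 : Cardinal.{u}) ^ weight X) →
      denseNoetherianType X = noetherianType X) :=
  ⟨fun _ _ _ h _ hD => noetherianType_dense_le h hD, fun _ _ _ _ _ _ => denseNoetherianType_eq⟩
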